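/- All rings are associative with unit, and modules are right modules unless stated otherwise. For a preadditive category $\mathcal{C}$, a right $\mathcal{C}$-module is an additive functor $\mathcal{C}^{\mathrm{op}} \to \mathrm{Ab}$, and $\operatorname{mod} \mathcal{C}$ denotes the category of finitely presented right $\mathcal{C}$-modules, i.e. those $F$ for which there is an exact sequence $\mathcal{C}(-,X) \to \mathcal{C}(-,Y) \to F \to 0$ induced by a morphism $X \to Y$ of $\mathcal{C}$. A category $\mathcal{C}$ is called $0$-abelian if it is additive and idempotent complete, the categories $\operatorname{mod} \mathcal{C}$ and $\operatorname{mod} \mathcal{C}^{\mathrm{op}}$ are abelian, and both have global dimension at most $1$. An object $X$ of an additive category $\mathcal{C}$ is an additive generator if every object of $\mathcal{C}$ is a direct summand of a finite direct sum of copies of $X$. A ring $\Lambda$ is semi-hereditary if every finitely generated submodule of a projective right $\Lambda$-module is projective and every finitely generated submodule of a projective left $\Lambda$-module is projective. Two rings are Morita equivalent if their categories of right modules are equivalent. For a ring $\Lambda$, $\operatorname{proj} \Lambda$ is the category of finitely generated projective right $\Lambda$-modules. Theorem. There is a bijective correspondence between the equivalence classes of $0$-abelian categories with additive generators and the Morita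 equivalence classes of semi-hereditary rings. The two mutually inverse maps are given as follows: (a) If $\mathcal{C}$ is a $0$-abelian category with an additive generator, then the class of $\mathcal{C}$ is sent to the class of the endomorphism ring $\operatorname{End}(X)$, where $X$ is any additive generator of $\mathcal{C}$; in particular, $\operatorname{End}(X)$ is semi-hereditary, and its Morita equivalence class depends neither on the choice of $X$ nor on the choice of $\mathcal{C}$ in its equivalence class. (b) If $\Lambda$ is a semi-hereditary ring, then the Morita equivalence class of $\Lambda$ is sent to the equivalence class of $\operatorname{proj} \Lambda$; in particular, $\operatorname{proj} \Lambda$ is a $0$-abelian category with an additive generator. -/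

import Mathlib

open CategoryTheory CategoryTheory.Limits

universe w v u

/-! ### Finitely presented modules over a category -/

/-- A right `C`-module (a contravariant additive functor from `C` to abelian groups) is finitely
presented if there is an exact sequence `C(-, X) ⟶ C(-, Y) ⟶ F ⟶ 0` for some morphism
`f : X ⟶ Y` of `C`. -/
def finitelyPresentedModule (C : Type w) [Category.{v} C] [Preadditive C] :
    ObjectProperty (Cᵒᵖ ⥤ AddCommGrpCat.{v}) := fun F =>
  F.Additive ∧
    ∃ (X Y : C) (f : X ⟶ Y) (p : preadditiveYoneda.obj Y ⟶ F)
      (zero : preadditiveYoneda.map f ≫ p = 0),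
      (ShortComplex.mk (preadditiveYoneda.map f) p zero).Exact ∧ Epi p

/-- The category `mod C` of finitely presented right `C`-modules, a full subcategory of the category
of right `C`-modules. Finitely presented left `C`-modules are the objects of `mod Cᵒᵖ`. -/
abbrev FPMod (C : Type w) [Category.{v} C] [Preadditive C] :=
  (finitelyPresentedModule C).FullSubcategory

/-- The global dimension of an abelian category: the supremum of the projective dimensions of its
objects. -/
noncomputable def globalDimension (A : Type w) [Category.{v} A] [Abelian A] : WithBot ℕ∞ :=
  ⨆ X : A, projectiveDimension X

/-- `C` is right coherent, that is, `mod C` is abelian, and `gl.dim (mod C) ≤ 1`. -/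
def IsRightCoherentGlobalDimLEOne (C : Type w) [Category.{v} C] [Preadditive C] : Prop :=
  ∃ _ : Abelian (FPMod C), globalDimension (FPMod C) ≤ 1

/-! ### 0-abelian categories -/

/-- A `0`-abelian category: an additive and idempotent complete category `C` which is right and left
coherent and for which the global dimensions of `mod C` and of `mod Cᵒᵖ` are at most one. -/
class IsZeroAbelian (C : Type w) [Category.{v} C] [Preadditive C] : Prop
    extends HasFiniteBiproducts C, IsIdempotentComplete C where
  right : IsRightCoherentGlobalDimLEOne C
  left : IsRightCoherentGlobalDimLEOne Cᵒᵖ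

/-- `X` is an additive generator of `C`, that is, `C = add X`: every object of `C` is a direct
summand of a finite direct sum of copies of `X`. -/
def IsAdditiveGenerator {C : Type w} [Category.{v} C] [Preadditive C] [HasFiniteBiproducts C]
    (X : C) : Prop :=
  haveI : HasBinaryBiproducts C := hasBinaryBiproducts_of_finite_biproducts C
  ∀ Y : C, ∃ (n : ℕ) (Z : C), Nonempty (Y ⊞ Z ≅ ⨁ fun _ : Fin n => X)

/-- `0`-abelian categories with an additive generator. -/
structure ZeroAbelianCatWithGenerator : Type (u + 2) where
  carrier : Type (u + 1)
  [category : Category.{u} carrier]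
  [preadditive : Preadditive carrier]
  [isZeroAbelian : IsZeroAbelian carrier]
  exists_generator : ∃ X : carrier, IsAdditiveGenerator X

attribute [instance] ZeroAbelianCatWithGenerator.category
  ZeroAbelianCatWithGenerator.preadditive ZeroAbelianCatWithGenerator.isZeroAbelian

/-- Equivalence of categories. Between additive categories an equivalence is always additive. -/
instance ZeroAbelianCatWithGenerator.equivalenceSetoid :
    Setoid ZeroAbelianCatWithGenerator.{u} where
  r C D := Nonempty (C.carrier ≌ D.carrier)
  iseqv :=
    { refl := fun _ => ⟨CategoryTheory.Equivalence.refl⟩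
      symm := fun ⟨e⟩ => ⟨e.symm⟩
      trans := fun ⟨e⟩ ⟨e'⟩ => ⟨e.trans e'⟩ }

/-- The class of a `0`-abelian category with an additive generator under equivalence. -/
abbrev ZeroAbelianClass := Quotient ZeroAbelianCatWithGenerator.equivalenceSetoid.{u}

/-! ### Semi-hereditary rings -/

/-- `R` is left semi-hereditary: every finitely generated submodule of a projective left `R`-module
is projective. -/
def IsLeftSemihereditary (R : Type u) [Ring R] : Prop :=
  ∀ (P : Type u) [AddCommGroup P] [Module R P] [Module.Projective R P] (N : Submodule R P),
    N.FG → Module.Projective R N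

/-- A ring is semi-hereditary if it is right semi-hereditary and left semi-hereditary. Right modules
are modules over the opposite ring. -/
structure IsSemihereditary (R : Type u) [Ring R] : Prop where
  right : IsLeftSemihereditary Rᵐᵒᵖ
  left : IsLeftSemihereditary R

/-- Semi-hereditary rings. -/
structure SemihereditaryRing : Type (u + 1) where
  carrier : Type u
  [ring : Ring carrier]
  isSemihereditary : IsSemihereditary carrier

attribute [instance] SemihereditaryRing.ring

/-- Morita equivalence of rings: the categories of right modules are equivalent. -/
instance SemihereditaryRing.moritaSetoid : Setoid SemihereditaryRing.{u} where
  r R S := IsMoritaEquivalent ℤ R.carrierᵐᵒᵖ S.carrierᵐᵒᵖ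
  iseqv :=
    { refl := fun _ => IsMoritaEquivalent.refl ℤ _
      symm := fun h => IsMoritaEquivalent.symm ℤ h
      trans := fun h h' => IsMoritaEquivalent.trans ℤ h h' }

/-- The class of a semi-hereditary ring under Morita equivalence. -/
abbrev SemihereditaryMoritaClass := Quotient SemihereditaryRing.moritaSetoid.{u}

/-- The category `proj R` of finitely generated projective right `R`-modules, a full subcategory of
the category of right `R`-modules. -/
abbrev ProjCat (R : Type u) [Ring R] :=
  ObjectProperty.FullSubcategory fun M : ModuleCat.{u} Rᵐᵒᵖ =>
    Module.Finite Rᵐᵒᵖ M ∧ Module.Projective Rᵐᵒᵖ M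

/-!
Both sides of the correspondence are governed by one elementary condition. Say that kernels split in
a preadditive category `C` (`KernelsSplit`) if every `f : X ⟶ Y` admits `e : X ⟶ X` with `e ≫ f = f`
such that `e` kills everything that `f` kills. Then `e` is an idempotent, and once it splits, `f` is
a split epimorphism onto the image of `e` followed by a monomorphism.

* For an additive idempotent complete `C`, kernels split in `C` if and only if `mod C` is abelian of
  global dimension at most one (`IsRightCoherentGlobalDimLEOne.kernelsSplit`,
  `KernelsSplit.isRightCoherentGlobalDimLEOne`). If `gl.dim (mod C) ≤ 1`, the kernel `K` of
  `C(-, Y) ⟶ coker C(-, f)` is projective, so `C(-, X) ⟶ K` splits, and the resulting idempotent of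
  `C(-, X)` is `C(-, e)` by the Yoneda lemma. Conversely, split kernels give weak kernels, so that
  finitely presented modules are closed under kernels, cokernels and finite products in the abelian
  category of all functors `Cᵒᵖ ⥤ Ab`; and replacing `X` by the image of `e` turns a presentation
  into a projective resolution of length one.
* If every object of `C` is a retract of a finite power of `X`, then kernels split in `C` if and
  only if they split for matrices over `(End X)ᵐᵒᵖ` (`KernelsSplit.matrixKernelsSplit`,
  `HasCoordinates.kernelsSplit`), which for any ring is equivalent to every finitely generated
  submodule of a projective module being projective (`isLeftSemihereditary_iff`).

Applied to `C` and `Cᵒᵖ`, this says that an additive idempotent complete `C` with generator `X` is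
`0`-abelian if and only if `End X` is semi-hereditary (`isZeroAbelian_iff`,
`isSemihereditary_end_iff`).

It remains to compare objects. The functor `Hom(X, -)` is an equivalence from `C` to `proj (End X)`
(`HasCoordinates.isEquivalence_toProjCat`), and `End R = R` in `proj R` (`endSelfEquiv`). For the
independence of choices, evaluation at any additive generator `X` is an equivalence from additive
functors `Cᵒᵖ ⥤+ Ab` to right `End X`-modules (`HasCoordinates.isEquivalence_evalFunctor`), so the
endomorphism rings of two generators are Morita equivalent. Conversely, a Morita equivalence
preserves projective modules and finitely generated modules, the latter because a module is finitely
generated if and only if the top element of its lattice of subobjects is compact; hence it restricts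
to an equivalence of the categories `proj` (`nonempty_projCat_equivalence`).

The condition that every object is a retract of a finite power of `X` is used in the form of a dual
basis: `∑ i, p i ≫ j i = 𝟙 Y` for finitely many `p i : Y ⟶ X` and `j i : X ⟶ Y` (`HasCoordinates`).
-/

/-! ### Semi-hereditary rings in terms of matrices -/

/-- Kernels of matrices over `S`, acting on row vectors from the right, split: each matrix `A`
admits a square matrix `E` with `E * A = A` that annihilates every row vector annihilated by `A`.
Over a noncommutative `S`, multiplication by a matrix on the right is linear for the left module of
row vectors. -/
def MatrixKernelsSplit (S : Type*) [Ring S] : Prop :=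
  ∀ (n m : ℕ) (A : Matrix (Fin n) (Fin m) S), ∃ E : Matrix (Fin n) (Fin n) S,
    E * A = A ∧ ∀ v : Fin n → S, Matrix.vecMul v A = 0 → Matrix.vecMul v E = 0

theorem MatrixKernelsSplit.of_ringEquiv {S T : Type*} [Ring S] [Ring T] (φ : S ≃+* T)
    (h : MatrixKernelsSplit S) : MatrixKernelsSplit T := by
  intro n m A
  obtain ⟨E, hE, hv⟩ := h n m (A.map φ.symm)
  refine ⟨E.map φ, ?_, fun v hvA => ?_⟩
  · have := congrArg (fun M => M.map φ) hE
    simpa [Matrix.map_mul, Matrix.map_map, Function.comp_def] using this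
  · have h1 : Matrix.vecMul (φ.symm ∘ v) (A.map φ.symm) = 0 := by
      funext j
      have := congrArg φ.symm (congrFun hvA j)
      simpa [Matrix.vecMul, dotProduct] using this
    funext j
    have := congrArg φ (congrFun (hv _ h1) j)
    simpa [Matrix.vecMul, dotProduct] using this

/-- The range of a matrix is a finitely generated submodule of a free module, so the matrix,
corestricted to its range, has a section. -/
theorem IsLeftSemihereditary.matrixKernelsSplit {S : Type u} [Ring S]
    (h : IsLeftSemihereditary S) : MatrixKernelsSplit S := by
  intro n m A
  let f : (Fin n → S) →ₗ[S] (Fin m → S) := A.vecMulLinear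
  have := h (Fin m → S) (LinearMap.range f) (Module.Finite.iff_fg.1 inferInstance)
  obtain ⟨s, hs⟩ := Module.projective_lifting_property f.rangeRestrict LinearMap.id
    f.surjective_rangeRestrict
  let g : (Fin n → S) →ₗ[S] (Fin n → S) := s ∘ₗ f.rangeRestrict
  have hg : ∀ v, Matrix.vecMul v (LinearMap.toMatrixRight' g) = g v := fun v =>
    LinearMap.congr_fun (LinearMap.toMatrixRight'.symm_apply_apply g) v
  refine ⟨LinearMap.toMatrixRight' g, ?_, fun v hv => ?_⟩
  · apply Matrix.ext_of_single_vecMul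
    intro i
    rw [← Matrix.vecMul_vecMul, hg]
    exact congrArg Subtype.val (LinearMap.congr_fun hs (f.rangeRestrict (Pi.single i 1)))
  · rw [hg]
    have : f.rangeRestrict v = 0 := Subtype.ext hv
    simp [g, this]

/-- A finitely generated submodule of a projective module is the range of a map out of `Sⁿ` whose
kernel is that of a matrix; the matrix `E` splitting this kernel provides a section. -/
theorem MatrixKernelsSplit.isLeftSemihereditary {S : Type u} [Ring S]
    (h : MatrixKernelsSplit S) : IsLeftSemihereditary S := by
  intro P _ _ _ N hN
  have : Module.Finite S N := Module.Finite.iff_fg.2 hN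
  obtain ⟨n, q, hq⟩ := Module.Finite.exists_fin' S N
  obtain ⟨σ, hσ⟩ := Module.projective_def.1 (inferInstance : Module.Projective S P)
  classical
  let f : (Fin n → S) →ₗ[S] (P →₀ S) := σ ∘ₗ N.subtype ∘ₗ q
  -- finitely many coordinates carry the images of the basis vectors
  let T : Finset P := Finset.univ.biUnion fun i : Fin n => (f (Pi.single i 1)).support
  let c : Fin T.card ≃ T := T.equivFin.symm
  let A : Matrix (Fin n) (Fin T.card) S := fun i k => f (Pi.single i 1) (c k)
  have hf : ∀ v : Fin n → S, f v = ∑ i, v i • f (Pi.single i 1) := fun v => by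
    conv_lhs => rw [pi_eq_sum_univ' v]
    simp [map_sum]
  have hAf : ∀ v k, Matrix.vecMul v A k = f v (c k) := fun v k => by
    rw [hf v]
    simp [Matrix.vecMul, dotProduct, A, Finsupp.finsetSum_apply]
  have hT : ∀ v p, p ∉ T → f v p = 0 := fun v p hp => by
    rw [hf v, Finsupp.finsetSum_apply]
    refine Finset.sum_eq_zero fun i _ => ?_
    have : p ∉ (f (Pi.single i 1)).support := fun h =>
      hp (Finset.mem_biUnion.2 ⟨i, Finset.mem_univ _, h⟩)
    simp [Finsupp.notMem_support_iff.1 this]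
  have hσi : Function.Injective σ := Function.LeftInverse.injective fun p => hσ p
  have hA : ∀ v : Fin n → S, q v = 0 → Matrix.vecMul v A = 0 := fun v hv => by
    funext k
    simp [hAf, f, hv]
  have hA' : ∀ v : Fin n → S, Matrix.vecMul v A = 0 → q v = 0 := fun v hv => by
    have : f v = 0 := by
      ext p
      by_cases hp : p ∈ T
      · simpa [hAf] using congrFun hv (c.symm ⟨p, hp⟩)
      · exact hT v p hp
    exact Subtype.ext (hσi (by simpa [f] using this))
  obtain ⟨E, hE, hv⟩ := h n T.card A
  let e : (Fin n → S) →ₗ[S] (Fin n → S) := E.vecMulLinear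
  have hker : LinearMap.ker q ≤ LinearMap.ker e := fun v hvq => hv v (hA v hvq)
  let s : N →ₗ[S] (Fin n → S) :=
    (LinearMap.ker q).liftQ e hker ∘ₗ (q.quotKerEquivOfSurjective hq).symm.toLinearMap
  refine Module.Projective.of_split s q (LinearMap.ext fun x => ?_)
  obtain ⟨v, rfl⟩ := hq x
  have hs : s (q v) = Matrix.vecMul v E := by
    have : (q.quotKerEquivOfSurjective hq).symm (q v) = Submodule.Quotient.mk v :=
      (LinearEquiv.symm_apply_eq _).2 rfl
    simp [s, e, this]
  rw [LinearMap.comp_apply, hs, LinearMap.id_apply, ← sub_eq_zero, ← map_sub]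
  refine hA' _ ?_
  rw [Matrix.sub_vecMul, Matrix.vecMul_vecMul, hE, sub_self]

/-! ### Split kernels and coordinates in a preadditive category -/

section Category
variable {C : Type w} [Category.{v} C] [Preadditive C]

variable (C) in
/-- Every morphism `f` out of `X` admits an endomorphism `e` of `X` with `e ≫ f = f` that
annihilates everything annihilated by `f`. Such an `e` is idempotent, and `𝟙 X - e` is a projection
onto the kernel of `f`. -/
def KernelsSplit : Prop :=
  ∀ ⦃X Y : C⦄ (f : X ⟶ Y), ∃ e : X ⟶ X, e ≫ f = f ∧
    ∀ ⦃Z : C⦄ (a : Z ⟶ X), a ≫ f = 0 → a ≫ e = 0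

/-- Every object `Y` is a retract of a finite power of `X`, expressed without biproducts: the
identity of `Y` is a finite sum of morphisms factoring through `X`. For modules and `X = R` this is
the existence of a finite dual basis. -/
def HasCoordinates (X : C) : Prop :=
  ∀ Y : C, ∃ (n : ℕ) (p : Fin n → (Y ⟶ X)) (j : Fin n → (X ⟶ Y)), ∑ i, p i ≫ j i = 𝟙 Y

protected theorem HasCoordinates.op {X : C} (h : HasCoordinates X) :
    HasCoordinates (Opposite.op X) := by
  intro Y
  obtain ⟨n, p, j, hpj⟩ := h Y.unop
  refine ⟨n, fun i => (j i).op, fun i => (p i).op, Quiver.Hom.unop_inj ?_⟩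
  simpa [unop_sum] using hpj

theorem IsAdditiveGenerator.hasCoordinates [HasFiniteBiproducts C] {X : C}
    (h : IsAdditiveGenerator X) : HasCoordinates X := by
  intro Y
  have : HasBinaryBiproducts C := hasBinaryBiproducts_of_finite_biproducts C
  obtain ⟨n, Z, ⟨φ⟩⟩ := h Y
  refine ⟨n, fun i => biprod.inl ≫ φ.hom ≫ biproduct.π _ i,
    fun i => biproduct.ι (fun _ : Fin n => X) i ≫ φ.inv ≫ biprod.fst, ?_⟩
  have htot := biproduct.total (f := fun _ : Fin n => X)
  calc ∑ i, (biprod.inl ≫ φ.hom ≫ biproduct.π _ i) ≫ biproduct.ι (fun _ : Fin n => X) i ≫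
        φ.inv ≫ biprod.fst
      = biprod.inl ≫ φ.hom ≫ (∑ i, biproduct.π _ i ≫ biproduct.ι (fun _ : Fin n => X) i) ≫
        φ.inv ≫ biprod.fst := by
        simp only [Preadditive.sum_comp, Preadditive.comp_sum, Category.assoc]
    _ = 𝟙 Y := by simp [htot]

theorem HasCoordinates.isAdditiveGenerator [HasFiniteBiproducts C] [IsIdempotentComplete C]
    {X : C} (h : HasCoordinates X) : IsAdditiveGenerator X := by
  intro Y
  have : HasBinaryBiproducts C := hasBinaryBiproducts_of_finite_biproducts C
  obtain ⟨n, p, j, hpj⟩ := h Y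
  let i : Y ⟶ ⨁ fun _ : Fin n => X := biproduct.lift p
  let r : (⨁ fun _ : Fin n => X) ⟶ Y := biproduct.desc j
  have hir : i ≫ r = 𝟙 Y := by simpa [i, r, biproduct.lift_desc] using hpj
  obtain ⟨Z, k, s, hks, hsk⟩ := IsIdempotentComplete.idempotents_split _ (𝟙 _ - r ≫ i)
    (by simp [reassoc_of% hir])
  have hmono : Mono k := ⟨fun a b hab => by simpa [hks] using congrArg (· ≫ s) hab⟩
  have hepi : Epi s := ⟨fun a b hab => by simpa [reassoc_of% hks] using congrArg (k ≫ ·) hab⟩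
  have his : i ≫ s = 0 := by
    rw [← cancel_mono k, Category.assoc, hsk]
    simp [reassoc_of% hir]
  have hkr : k ≫ r = 0 := by
    rw [← cancel_epi s, ← Category.assoc, hsk]
    simp [hir]
  refine ⟨n, Z, ⟨⟨biprod.desc i k, biprod.lift r s, ?_, ?_⟩⟩⟩
  · ext <;> simp [hir, his, hkr, hks]
  · simp [biprod.lift_desc, hsk]

theorem KernelsSplit.matrixKernelsSplit [HasFiniteBiproducts C] (h : KernelsSplit C) (X : C) :
    MatrixKernelsSplit (End X)ᵐᵒᵖ := by
  intro n m A
  let g : (⨁ fun _ : Fin n => X) ⟶ ⨁ fun _ : Fin m => X :=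
    biproduct.matrix fun i k => (A i k).unop
  obtain ⟨e, he, ha⟩ := h g
  refine ⟨Matrix.of fun i k => MulOpposite.op (biproduct.components e i k), ?_, fun v hv => ?_⟩
  · ext i k
    apply MulOpposite.unop_injective
    have := congrArg (fun t => biproduct.components t i k) he
    rw [Matrix.mul_apply, Finset.unop_sum]
    calc ∑ l, biproduct.components e i l ≫ (A l k).unop
        = biproduct.components (e ≫ g) i k := by
          simp [biproduct.components, g, biproduct.matrix_π, biproduct.desc_eq,
            Preadditive.comp_sum]
      _ = (A i k).unop := by simp [he, g]
  · let a : X ⟶ ⨁ fun _ : Fin n => X := biproduct.lift fun i => (v i).unop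
    have hag : a ≫ g = 0 := by
      ext k
      have : ∑ i, (v i).unop ≫ (A i k).unop = 0 := by
        have := congrArg MulOpposite.unop (congrFun hv k)
        rwa [Matrix.vecMul, dotProduct, Finset.unop_sum] at this
      simpa [a, g, biproduct.lift_matrix] using this
    have hae := ha a hag
    funext k
    apply MulOpposite.unop_injective
    rw [Matrix.vecMul, dotProduct, Finset.unop_sum]
    calc ∑ i, (v i).unop ≫ biproduct.components e i k = (a ≫ e) ≫ biproduct.π _ k := by
          simp [biproduct.components, a, biproduct.lift_eq, Preadditive.sum_comp]
      _ = 0 := by simp [hae]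

theorem HasCoordinates.kernelsSplit {X : C} (hX : HasCoordinates X)
    (h : MatrixKernelsSplit (End X)ᵐᵒᵖ) : KernelsSplit C := by
  intro M N f
  obtain ⟨n, p, j, hpj⟩ := hX M
  obtain ⟨m, q, l, hql⟩ := hX N
  obtain ⟨E, hE, hv⟩ := h n m (Matrix.of fun i k => MulOpposite.op (j i ≫ f ≫ q k))
  have hE' : ∀ i k, ∑ i', (E i i').unop ≫ j i' ≫ f ≫ q k = j i ≫ f ≫ q k := fun i k => by
    have := congrArg MulOpposite.unop (congrFun (congrFun hE i) k)
    rwa [Matrix.mul_apply, Finset.unop_sum] at this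
  have hN : ∀ {Z : C} (g g' : Z ⟶ N), (∀ k, g ≫ q k = g' ≫ q k) → g = g' := fun g g' hg => by
    rw [← Category.comp_id g, ← Category.comp_id g', ← hql, Preadditive.comp_sum,
      Preadditive.comp_sum]
    exact Finset.sum_congr rfl fun k _ => by rw [← Category.assoc, hg k, Category.assoc]
  refine ⟨∑ i, p i ≫ ∑ i', (E i i').unop ≫ j i', hN _ _ fun k => ?_, fun Z a haf => ?_⟩
  · have := congrArg (· ≫ f ≫ q k) hpj
    simp only [Preadditive.sum_comp, Category.assoc, hE', Category.id_comp] at this ⊢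
    exact this
  · obtain ⟨t, p', j', hpj'⟩ := hX Z
    have hv' : ∀ r i', ∑ i, (j' r ≫ a ≫ p i) ≫ (E i i').unop = 0 := fun r i' => by
      have := hv (fun i => MulOpposite.op (j' r ≫ a ≫ p i)) (by
        funext k
        apply MulOpposite.unop_injective
        rw [Matrix.vecMul, dotProduct, Finset.unop_sum]
        change ∑ i, (j' r ≫ a ≫ p i) ≫ j i ≫ f ≫ q k = 0
        have := congrArg (fun t => j' r ≫ a ≫ t ≫ f ≫ q k) hpj
        simp only [Preadditive.sum_comp, Preadditive.comp_sum, Category.assoc, Category.id_comp]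
          at this ⊢
        rw [this, reassoc_of% haf]
        simp)
      have := congrArg MulOpposite.unop (congrFun this i')
      rwa [Matrix.vecMul, dotProduct, Finset.unop_sum] at this
    have hr : ∀ r, j' r ≫ a ≫ ∑ i, p i ≫ ∑ i', (E i i').unop ≫ j i' = 0 := fun r => by
      simp only [Preadditive.comp_sum]
      rw [Finset.sum_comm]
      refine Finset.sum_eq_zero fun i' _ => ?_
      have := congrArg (· ≫ j i') (hv' r i')
      simpa only [Preadditive.sum_comp, Category.assoc, zero_comp] using this
    rw [← Category.id_comp a, ← hpj', Preadditive.sum_comp, Preadditive.sum_comp]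
    exact Finset.sum_eq_zero fun r _ => by rw [Category.assoc, Category.assoc, hr, comp_zero]

end Category

/-! ### Presentations of modules over a category by elements -/

section FinitelyPresented
open Opposite
variable {C : Type w} [Category.{v} C] [Preadditive C]

theorem exact_iff_forall_app {J : Type w} [Category.{v} J]
    (S : ShortComplex (J ⥤ AddCommGrpCat.{u})) :
    S.Exact ↔ ∀ (j : J) (x : S.X₂.obj j), S.g.app j x = 0 → ∃ y : S.X₁.obj j, S.f.app j y = x := by
  have key : S.Exact ↔ ∀ j, (S.map ((evaluation J AddCommGrpCat.{u}).obj j)).Exact := by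
    refine ⟨fun h j => h.map _, fun h => ?_⟩
    rw [ShortComplex.exact_iff_isZero_homology, Functor.isZero_iff]
    intro j
    exact ((ShortComplex.exact_iff_isZero_homology _).1 (h j)).of_iso
      (S.mapHomologyIso ((evaluation J AddCommGrpCat.{u}).obj j)).symm
  rw [key]
  exact forall_congr' fun j => ShortComplex.ab_exact_iff _

/-- The morphism `C(-, Y) ⟶ F` that corresponds to `t ∈ F(Y)` under the Yoneda lemma. -/
def homOfElement (F : Cᵒᵖ ⥤ AddCommGrpCat.{v}) [F.Additive] {Y : C} (t : F.obj (op Y)) :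
    preadditiveYoneda.obj Y ⟶ F where
  app Z := AddCommGrpCat.ofHom
    (show (Z.unop ⟶ Y) →+ F.obj Z from
    { toFun := fun y => F.map y.op t
      map_zero' := by simp
      map_add' := fun a b => by simp [F.map_add] })
  naturality Z W g := by
    ext y
    let y' : Z.unop ⟶ Y := y
    change F.map (g.unop ≫ y').op t = F.map g (F.map y'.op t)
    simp

theorem app_eq_map_app_id {F : Cᵒᵖ ⥤ AddCommGrpCat.{v}} {Y Z : C}
    (p : preadditiveYoneda.obj Y ⟶ F) (y : Z ⟶ Y) :
    p.app (op Z) y = F.map y.op (p.app (op Y) (𝟙 Y)) := by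
  refine Eq.trans ?_ (NatTrans.naturality_apply p y.op (𝟙 Y))
  exact congrArg (p.app (op Z)) (Category.comp_id y).symm

/-- The element `t ∈ F(Y)` presents `F` with relations `f`, that is, the sequence
`C(-, X) ⟶ C(-, Y) ⟶ F ⟶ 0` given by `f` and `t` is exact. -/
structure IsPresentedBy (F : Cᵒᵖ ⥤ AddCommGrpCat.{v}) {X Y : C} (f : X ⟶ Y) (t : F.obj (op Y)) :
    Prop where
  map_eq_zero_iff : ∀ {Z : C} (y : Z ⟶ Y), F.map y.op t = 0 ↔ ∃ x : Z ⟶ X, x ≫ f = y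
  exists_map_eq : ∀ {Z : C} (s : F.obj (op Z)), ∃ y : Z ⟶ Y, F.map y.op t = s

theorem finitelyPresentedModule_iff (F : Cᵒᵖ ⥤ AddCommGrpCat.{v}) :
    finitelyPresentedModule C F ↔ F.Additive ∧
      ∃ (X Y : C) (f : X ⟶ Y) (t : F.obj (op Y)), IsPresentedBy F f t := by
  constructor
  · rintro ⟨hF, X, Y, f, p, zero, hex, hp⟩
    rw [exact_iff_forall_app] at hex
    refine ⟨hF, X, Y, f, p.app (op Y) (𝟙 Y), ⟨fun {Z} y => ?_, fun {Z} s => ?_⟩⟩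
    · rw [← app_eq_map_app_id]
      refine ⟨fun h => hex (op Z) y h, ?_⟩
      rintro ⟨x, rfl⟩
      exact ConcreteCategory.congr_hom (NatTrans.congr_app zero (op Z)) x
    · obtain ⟨y, hy⟩ := (AddCommGrpCat.epi_iff_surjective _).1
        ((NatTrans.epi_iff_epi_app p).1 hp (op Z)) s
      exact ⟨y, (app_eq_map_app_id p y).symm.trans hy⟩
  · rintro ⟨hF, X, Y, f, t, h⟩
    refine ⟨hF, X, Y, f, homOfElement F t, ?_, ?_, ?_⟩
    · ext Z x
      exact (h.map_eq_zero_iff _).2 ⟨x, rfl⟩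
    · rw [exact_iff_forall_app]
      exact fun Z y hy => (h.map_eq_zero_iff (Z := Z.unop) y).1 hy
    · rw [NatTrans.epi_iff_epi_app]
      exact fun Z => (AddCommGrpCat.epi_iff_surjective _).2 fun s => h.exists_map_eq (Z := Z.unop) s

/-- The weak pullback is the weak kernel `𝟙 - e` of the morphism `X ⊞ Y ⟶ Z` with components `f` and
`-g`. -/
theorem KernelsSplit.exists_weak_pullback [HasBinaryBiproducts C] (h : KernelsSplit C) {X Y Z : C}
    (f : X ⟶ Z) (g : Y ⟶ Z) : ∃ (W : C) (p : W ⟶ X) (q : W ⟶ Y), p ≫ f = q ≫ g ∧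
      ∀ {T : C} (x : T ⟶ X) (y : T ⟶ Y), x ≫ f = y ≫ g → ∃ w : T ⟶ W, w ≫ p = x ∧ w ≫ q = y := by
  obtain ⟨e, he, ha⟩ := h (biprod.desc f (-g))
  have hk : (𝟙 _ - e) ≫ biprod.desc f (-g) = 0 := by simp [he]
  refine ⟨X ⊞ Y, (𝟙 _ - e) ≫ biprod.fst, (𝟙 _ - e) ≫ biprod.snd, ?_, fun {T} x y hxy => ?_⟩
  · rw [← sub_eq_zero, ← hk]
    simp [biprod.desc_eq, Preadditive.comp_add, sub_eq_add_neg]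
  · have h0 := ha (biprod.lift x y) (by simp [hxy])
    exact ⟨biprod.lift x y, by simp [reassoc_of% h0],
      by simp [reassoc_of% h0]⟩

theorem additive_of_injective {F G : Cᵒᵖ ⥤ AddCommGrpCat.{v}} (k : F ⟶ G) [G.Additive]
    (hk : ∀ Z, Function.Injective (k.app Z)) : F.Additive where
  map_add {Z W f g} := by
    ext z
    apply hk
    simp [NatTrans.naturality_apply, G.map_add]

theorem additive_of_surjective {F G : Cᵒᵖ ⥤ AddCommGrpCat.{v}} (k : F ⟶ G) [F.Additive]
    (hk : ∀ Z, Function.Surjective (k.app Z)) : G.Additive where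
  map_add {Z W f g} := by
    ext z
    obtain ⟨z, rfl⟩ := hk _ z
    simp [← NatTrans.naturality_apply, F.map_add]

/-- Generators of the kernel of `α` are the weak pullback `W` of a lift `a` of `α` and the relations
`g` of the target; its relations are the weak pullback of `W ⟶ X₀` and the relations `f` of the
source. -/
theorem finitelyPresentedModule_of_kernel [HasBinaryBiproducts C] (h : KernelsSplit C)
    {F G K : Cᵒᵖ ⥤ AddCommGrpCat.{v}} (k : K ⟶ F) (α : F ⟶ G)
    (hk : ∀ Z, Function.Injective (k.app Z))
    (hex : ∀ Z (x : F.obj Z), α.app Z x = 0 ↔ ∃ y, k.app Z y = x)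
    (hF : finitelyPresentedModule C F) (hG : finitelyPresentedModule C G) :
    finitelyPresentedModule C K := by
  rw [finitelyPresentedModule_iff] at hF hG ⊢
  obtain ⟨_, X₁, X₀, f, t, ht⟩ := hF
  obtain ⟨_, Y₁, Y₀, g, s, hs⟩ := hG
  obtain ⟨a, ha⟩ := hs.exists_map_eq (α.app _ t)
  obtain ⟨W, p, q, hpq, hW⟩ := h.exists_weak_pullback a g
  obtain ⟨V, p', q', hpq', hV⟩ := h.exists_weak_pullback p f
  have hα : ∀ {Z : C} (x : Z ⟶ X₀), α.app _ (F.map x.op t) = G.map (x ≫ a).op s := fun x => by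
    simp [NatTrans.naturality_apply, ha]
  obtain ⟨κ, hκ⟩ := (hex (op W) (F.map p.op t)).1 (by
    rw [hα, hpq]
    exact (hs.map_eq_zero_iff _).2 ⟨q, rfl⟩)
  have hkκ : ∀ {Z : C} (y : Z ⟶ W), k.app _ (K.map y.op κ) = F.map (y ≫ p).op t := fun y => by
    simp [NatTrans.naturality_apply, hκ]
  refine ⟨additive_of_injective k hk, V, W, p', κ, ⟨fun {Z} y => ?_, fun {Z} z => ?_⟩⟩
  · rw [← (hk _).eq_iff, map_zero, hkκ, ht.map_eq_zero_iff]
    constructor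
    · rintro ⟨x, hx⟩
      obtain ⟨v, hv, -⟩ := hV y x hx.symm
      exact ⟨v, hv⟩
    · rintro ⟨v, rfl⟩
      exact ⟨v ≫ q', by rw [Category.assoc, ← hpq', Category.assoc]⟩
  · obtain ⟨x, hx⟩ := ht.exists_map_eq (k.app _ z)
    have h0 : α.app _ (k.app _ z) = 0 := (hex _ _).2 ⟨z, rfl⟩
    rw [← hx, hα, hs.map_eq_zero_iff] at h0
    obtain ⟨y, hy⟩ := h0
    obtain ⟨w, hw, -⟩ := hW x y hy.symm
    exact ⟨w, hk _ (by rw [hkκ, hw, hx])⟩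

/-- The cokernel of `α` has the generators of the target, and as relations those of the target
together with a lift `a` of `α`. -/
theorem finitelyPresentedModule_of_cokernel [HasBinaryBiproducts C]
    {F G Q : Cᵒᵖ ⥤ AddCommGrpCat.{v}} (α : F ⟶ G) (π : G ⟶ Q)
    (hπ : ∀ Z, Function.Surjective (π.app Z))
    (hex : ∀ Z (x : G.obj Z), π.app Z x = 0 ↔ ∃ y, α.app Z y = x)
    (hF : finitelyPresentedModule C F) (hG : finitelyPresentedModule C G) :
    finitelyPresentedModule C Q := by
  rw [finitelyPresentedModule_iff] at hF hG ⊢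
  obtain ⟨_, X₁, X₀, f, t, ht⟩ := hF
  obtain ⟨_, Y₁, Y₀, g, s, hs⟩ := hG
  obtain ⟨a, ha⟩ := hs.exists_map_eq (α.app _ t)
  have hα : ∀ {Z : C} (x : Z ⟶ X₀), α.app _ (F.map x.op t) = G.map (x ≫ a).op s := fun x => by
    simp [NatTrans.naturality_apply, ha]
  have hπs : ∀ {Z : C} (y : Z ⟶ Y₀), Q.map y.op (π.app _ s) = π.app _ (G.map y.op s) := fun y => by
    simp [NatTrans.naturality_apply]
  refine ⟨additive_of_surjective π hπ, X₀ ⊞ Y₁, Y₀, biprod.desc a g, π.app _ s,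
    ⟨fun {Z} y => ?_, fun {Z} z => ?_⟩⟩
  · rw [hπs, hex]
    constructor
    · rintro ⟨z, hz⟩
      obtain ⟨x, rfl⟩ := ht.exists_map_eq z
      rw [hα, ← sub_eq_zero] at hz
      obtain ⟨y', hy'⟩ := (hs.map_eq_zero_iff (y - x ≫ a)).1 (by
        rw [op_sub, G.map_sub, ← neg_eq_zero, ← hz]
        simp)
      exact ⟨biprod.lift x y', by simp [hy']⟩
    · rintro ⟨x, rfl⟩
      refine ⟨F.map (x ≫ biprod.fst).op t, ?_⟩
      have h0 := (hs.map_eq_zero_iff ((x ≫ biprod.snd) ≫ g)).2 ⟨_, rfl⟩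
      have hx : x ≫ biprod.desc a g = (x ≫ biprod.fst) ≫ a + (x ≫ biprod.snd) ≫ g := by
        simp [biprod.desc_eq]
      rw [hα, hx, op_add, G.map_add]
      rw [AddCommGrpCat.hom_add_apply, h0, add_zero]
  · obtain ⟨z, rfl⟩ := hπ _ z
    obtain ⟨y, rfl⟩ := hs.exists_map_eq z
    exact ⟨y, hπs y⟩

theorem finitelyPresentedModule_of_biproduct [HasBinaryBiproducts C]
    {F G B : Cᵒᵖ ⥤ AddCommGrpCat.{v}} (p : B ⟶ F) (q : B ⟶ G) (i : F ⟶ B) (j : G ⟶ B)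
    (hip : i ≫ p = 𝟙 F) (hjq : j ≫ q = 𝟙 G) (hiq : i ≫ q = 0) (hjp : j ≫ p = 0)
    (htot : p ≫ i + q ≫ j = 𝟙 B)
    (hF : finitelyPresentedModule C F) (hG : finitelyPresentedModule C G) :
    finitelyPresentedModule C B := by
  rw [finitelyPresentedModule_iff] at hF hG ⊢
  obtain ⟨_, X₁, X₀, f, t, ht⟩ := hF
  obtain ⟨_, Y₁, Y₀, g, s, hs⟩ := hG
  have hip' : ∀ Z x, p.app Z (i.app Z x) = x := fun Z x =>
    ConcreteCategory.congr_hom (NatTrans.congr_app hip Z) x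
  have hjq' : ∀ Z x, q.app Z (j.app Z x) = x := fun Z x =>
    ConcreteCategory.congr_hom (NatTrans.congr_app hjq Z) x
  have hiq' : ∀ Z x, q.app Z (i.app Z x) = 0 := fun Z x =>
    ConcreteCategory.congr_hom (NatTrans.congr_app hiq Z) x
  have hjp' : ∀ Z x, p.app Z (j.app Z x) = 0 := fun Z x =>
    ConcreteCategory.congr_hom (NatTrans.congr_app hjp Z) x
  have htot' : ∀ Z x, i.app Z (p.app Z x) + j.app Z (q.app Z x) = x := fun Z x =>
    ConcreteCategory.congr_hom (NatTrans.congr_app htot Z) x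
  have hext : ∀ Z (x y : B.obj Z), p.app Z x = p.app Z y → q.app Z x = q.app Z y → x = y :=
    fun Z x y hp hq => by rw [← htot' Z x, ← htot' Z y, hp, hq]
  let b : B.obj (op (X₀ ⊞ Y₀)) :=
    i.app _ (F.map biprod.fst.op t) + j.app _ (G.map biprod.snd.op s)
  have hpb : ∀ {Z : C} (z : Z ⟶ X₀ ⊞ Y₀),
      p.app _ (B.map z.op b) = F.map (z ≫ biprod.fst).op t := fun z => by
    rw [NatTrans.naturality_apply]
    simp [b, hip', hjp']
  have hqb : ∀ {Z : C} (z : Z ⟶ X₀ ⊞ Y₀),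
      q.app _ (B.map z.op b) = G.map (z ≫ biprod.snd).op s := fun z => by
    rw [NatTrans.naturality_apply]
    simp [b, hjq', hiq']
  refine ⟨⟨fun {Z W f g} => ?_⟩, X₁ ⊞ Y₁, X₀ ⊞ Y₀, biprod.map f g, b,
    ⟨fun {Z} y => ?_, fun {Z} z => ?_⟩⟩
  · ext z
    apply hext
    · simp [NatTrans.naturality_apply, F.map_add]
    · simp [NatTrans.naturality_apply, G.map_add]
  · constructor
    · intro h0
      obtain ⟨x, hx⟩ := (ht.map_eq_zero_iff (y ≫ biprod.fst)).1 (by rw [← hpb, h0, map_zero])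
      obtain ⟨x', hx'⟩ := (hs.map_eq_zero_iff (y ≫ biprod.snd)).1 (by rw [← hqb, h0, map_zero])
      exact ⟨biprod.lift x x', by ext <;> simp [hx, hx']⟩
    · rintro ⟨x, rfl⟩
      apply hext
      · rw [hpb, map_zero, ht.map_eq_zero_iff]
        exact ⟨x ≫ biprod.fst, by simp⟩
      · rw [hqb, map_zero, hs.map_eq_zero_iff]
        exact ⟨x ≫ biprod.snd, by simp⟩
  · obtain ⟨x, hx⟩ := ht.exists_map_eq (p.app _ z)
    obtain ⟨y, hy⟩ := hs.exists_map_eq (q.app _ z)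
    exact ⟨biprod.lift x y, hext _ _ _ (by simp [hpb, ← hx]) (by simp [hqb, ← hy])⟩

end FinitelyPresented

/-! ### Finitely presented modules of global dimension at most one -/

section ModAbelian
open Opposite ZeroObject
variable {C : Type w} [Category.{v} C] [Preadditive C]

theorem epi_of_surjective_app {F G : FPMod C} (p : F ⟶ G)
    (h : ∀ Z, Function.Surjective (p.hom.app Z)) : Epi p := by
  have : Epi ((finitelyPresentedModule C).ι.map p) :=
    (NatTrans.epi_iff_epi_app _).2 fun Z => (AddCommGrpCat.epi_iff_surjective _).2 (h Z)
  exact (finitelyPresentedModule C).ι.epi_of_epi_map this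

section Additive
variable [HasFiniteBiproducts C]

instance finitelyPresentedModule_containsZero :
    (finitelyPresentedModule C).ContainsZero where
  exists_zero := by
    have h0 : IsZero (0 : Cᵒᵖ ⥤ AddCommGrpCat.{v}) := isZero_zero _
    have hs : ∀ Z (x : (0 : Cᵒᵖ ⥤ AddCommGrpCat.{v}).obj Z), x = 0 := fun Z x => by
      have := ((Functor.isZero_iff _).1 h0 Z).eq_of_src (𝟙 _) 0
      exact ConcreteCategory.congr_hom this x
    have : HasZeroObject C := inferInstance
    refine ⟨_, h0, (finitelyPresentedModule_iff _).2 ⟨⟨fun {Z W f g} => ?_⟩, 0, 0, 𝟙 _, 0,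
      ⟨fun y => ⟨fun _ => ⟨y, Category.comp_id y⟩, fun _ => hs _ _⟩,
        fun s => ⟨0, (hs _ _).trans (hs _ _).symm⟩⟩⟩⟩
    exact (((Functor.isZero_iff _).1 h0 _).eq_of_src _ _)

instance finitelyPresentedModule_isClosedUnderCokernels :
    (finitelyPresentedModule C).IsClosedUnderCokernels where
  cokernels_le := by
    have : HasBinaryBiproducts C := hasBinaryBiproducts_of_finite_biproducts C
    rintro _ ⟨α, c, hc, hF, hG⟩
    have hepi : Epi c.π := Cofork.IsColimit.epi hc
    have hex := (exact_iff_forall_app _).1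
      (ShortComplex.exact_of_g_is_cokernel (ShortComplex.mk α c.π c.condition)
        (IsColimit.ofIsoColimit hc (Cofork.ext (Iso.refl _))))
    refine finitelyPresentedModule_of_cokernel α c.π
      (fun Z => (AddCommGrpCat.epi_iff_surjective _).1 ((NatTrans.epi_iff_epi_app _).1 hepi Z))
      (fun Z x => ⟨hex Z x, ?_⟩) hF hG
    rintro ⟨y, rfl⟩
    exact ConcreteCategory.congr_hom (NatTrans.congr_app c.condition Z) y

theorem finitelyPresentedModule_isClosedUnderIsomorphisms :
    (finitelyPresentedModule C).IsClosedUnderIsomorphisms where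
  of_iso {F G} e hF := by
    have : HasBinaryBiproducts C := hasBinaryBiproducts_of_finite_biproducts C
    have hinj : ∀ Z, Function.Injective (e.hom.app Z) := fun Z =>
      (AddCommGrpCat.mono_iff_injective _).1 inferInstance
    refine finitelyPresentedModule_of_cokernel (0 : F ⟶ F) e.hom
      (fun Z => (AddCommGrpCat.epi_iff_surjective _).1 inferInstance) (fun Z x => ?_) hF hF
    rw [map_eq_zero_iff _ (hinj Z)]
    exact ⟨fun h => ⟨0, h.symm⟩, fun ⟨_, h⟩ => h.symm⟩

instance finitelyPresentedModule_isClosedUnderFiniteProducts :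
    (finitelyPresentedModule C).IsClosedUnderFiniteProducts := by
  have : HasBinaryBiproducts C := hasBinaryBiproducts_of_finite_biproducts C
  have := finitelyPresentedModule_isClosedUnderIsomorphisms (C := C)
  have : (finitelyPresentedModule C).IsClosedUnderBinaryProducts := by
    refine ObjectProperty.IsClosedUnderLimitsOfShape.mk' ?_
    rintro _ ⟨D, hD⟩
    refine (finitelyPresentedModule C).prop_of_iso
      (biprod.isoProd _ _ ≪≫ (HasLimit.isoOfNatIso (diagramIsoPair D)).symm) ?_
    exact finitelyPresentedModule_of_biproduct biprod.fst biprod.snd biprod.inl biprod.inr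
      biprod.inl_fst biprod.inr_snd biprod.inl_snd biprod.inr_fst biprod.total (hD _) (hD _)
  exact ObjectProperty.IsClosedUnderFiniteProducts.mk'

theorem KernelsSplit.isClosedUnderKernels (h : KernelsSplit C) :
    (finitelyPresentedModule C).IsClosedUnderKernels where
  kernels_le := by
    have : HasBinaryBiproducts C := hasBinaryBiproducts_of_finite_biproducts C
    rintro _ ⟨α, c, hc, hF, hG⟩
    have hmono : Mono c.ι := Fork.IsLimit.mono hc
    have hex := (exact_iff_forall_app _).1
      (ShortComplex.exact_of_f_is_kernel (ShortComplex.mk c.ι α c.condition)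
        (IsLimit.ofIsoLimit hc (Fork.ext (Iso.refl _))))
    refine finitelyPresentedModule_of_kernel h c.ι α
      (fun Z => (AddCommGrpCat.mono_iff_injective _).1 ((NatTrans.mono_iff_mono_app _).1 hmono Z))
      (fun Z x => ⟨hex Z x, ?_⟩) hF hG
    rintro ⟨y, rfl⟩
    exact ConcreteCategory.congr_hom (NatTrans.congr_app c.condition Z) y


/-- The representable module `C(-, X)`, presented by the relations `0 ⟶ X`. -/
def representableModule (X : C) : FPMod C :=
  ⟨preadditiveYoneda.obj X, by
    refine (finitelyPresentedModule_iff _).2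
      ⟨inferInstance, 0, X, 0, 𝟙 X, ⟨fun y => ?_, fun s => ?_⟩⟩
    · change y ≫ 𝟙 X = 0 ↔ _
      rw [Category.comp_id]
      exact ⟨fun h => ⟨0, by simp [h]⟩, fun ⟨x, hx⟩ => by rw [← hx, comp_zero]⟩
    · exact ⟨s, Category.comp_id (obj := C) s⟩⟩

/-- Epimorphisms of `mod C` are pointwise surjective, because cokernels in `mod C` are computed
pointwise. This holds whether or not `mod C` is abelian. -/
theorem surjective_app_of_epi {F G : FPMod C} (p : F ⟶ G) [Epi p] (Z : Cᵒᵖ) :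
    Function.Surjective (p.hom.app Z) := by
  have := (finitelyPresentedModule C).preservesEpimorphisms_ι_of_isNormalMonoCategory
  have : Epi p.hom := inferInstanceAs (Epi ((finitelyPresentedModule C).ι.map p))
  exact (AddCommGrpCat.epi_iff_surjective _).1 ((NatTrans.epi_iff_epi_app _).1 this Z)

instance additive_obj (F : FPMod C) : F.obj.Additive := ((finitelyPresentedModule_iff _).1 F.2).1

instance projective_representableModule (X : C) : Projective (representableModule X) where
  factors {E F} f p _ := by
    obtain ⟨t, ht⟩ := surjective_app_of_epi p (op X) (f.hom.app (op X) (𝟙 X))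
    refine ⟨ObjectProperty.homMk (homOfElement E.obj t), ?_⟩
    ext Z y
    change p.hom.app Z (E.obj.map (Quiver.Hom.op y) t) = f.hom.app Z y
    rw [NatTrans.naturality_apply, ht]
    exact (app_eq_map_app_id f.hom (Z := Z.unop) y).symm

/-- In an abelian category of global dimension at most one, an epimorphism out of a projective
object has a projective kernel. The zero morphisms are those of an arbitrary instance, so that the
lemma applies to `mod C` with an abelian structure of which nothing else is known. -/
theorem exists_projective_kernel {A : Type*} [Category* A] [hz : HasZeroMorphisms A]
    (hA : ∃ _ : Abelian A, globalDimension A ≤ 1) {P F : A} [Projective P] (p : P ⟶ F) [Epi p] :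
    ∃ (K : A) (k : K ⟶ P), Projective K ∧ Mono k ∧ k ≫ p = 0 ∧
      ∀ {T : A} (g : T ⟶ P), g ≫ p = 0 → ∃ g' : T ⟶ K, g' ≫ k = g := by
  obtain ⟨_, hdim⟩ := hA
  -- A category carries at most one family of zero morphisms.
  obtain rfl : hz = Preadditive.preadditiveHasZeroMorphisms := Subsingleton.elim _ _
  have hF : HasProjectiveDimensionLT F 2 :=
    (projectiveDimension_le_iff F 1).1 ((le_iSup (fun X : A => projectiveDimension X) F).trans hdim)
  have hS : (ShortComplex.mk (kernel.ι p) p (kernel.condition p)).ShortExact :=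
    { exact := ShortComplex.exact_kernel p }
  have hK : HasProjectiveDimensionLT (kernel p) 1 :=
    hS.hasProjectiveDimensionLT_X₁ 1 inferInstance hF
  exact ⟨kernel p, kernel.ι p, inferInstance, inferInstance, kernel.condition p,
    fun g hg => ⟨kernel.lift p g hg, kernel.lift_ι _ _ _⟩⟩

/-- The morphism `C(-, f)` of finitely presented modules. -/
def representableMap {X Y : C} (f : X ⟶ Y) : representableModule X ⟶ representableModule Y :=
  ObjectProperty.homMk (preadditiveYoneda.map f)

theorem representableMap_comp {X Y Z : C} (f : X ⟶ Y) (g : Y ⟶ Z) :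
    representableMap (f ≫ g) = representableMap f ≫ representableMap g :=
  ObjectProperty.hom_ext _ (preadditiveYoneda.map_comp f g)

theorem representableMap_surjective {X Y : C} (φ : representableModule X ⟶ representableModule Y) :
    ∃ f : X ⟶ Y, representableMap f = φ := by
  obtain ⟨f, hf⟩ := preadditiveYoneda.map_surjective φ.hom
  exact ⟨f, ObjectProperty.hom_ext _ hf⟩

theorem representableMap_injective {X Y : C} {f g : X ⟶ Y}
    (h : representableMap f = representableMap g) : f = g :=
  preadditiveYoneda.map_injective (congrArg (fun φ => φ.hom) h)

theorem representableMap_zero (X Y : C) : representableMap (0 : X ⟶ Y) = 0 := by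
  ext Z y
  exact comp_zero

theorem IsRightCoherentGlobalDimLEOne.kernelsSplit (h : IsRightCoherentGlobalDimLEOne C) :
    KernelsSplit C := by
  intro X Y f
  let F : FPMod C := ⟨cokernel (preadditiveYoneda.map f),
    (finitelyPresentedModule C).prop_cokernel _ (representableModule X).2 (representableModule Y).2⟩
  let p : representableModule Y ⟶ F := ObjectProperty.homMk (cokernel.π (preadditiveYoneda.map f))
  have hp : ∀ {Z : C} (y : Z ⟶ Y), representableMap y ≫ p = 0 → ∃ x : Z ⟶ X, x ≫ f = y := by
    intro Z y hy
    refine (exact_iff_forall_app _).1 (ShortComplex.exact_cokernel (preadditiveYoneda.map f))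
      (op Z) y ?_
    have := ConcreteCategory.congr_hom
      (NatTrans.congr_app (congrArg InducedCategory.Hom.hom hy) (op Z)) (𝟙 Z)
    refine Eq.trans ?_ this
    exact congrArg (p.hom.app (op Z)) (Category.id_comp y).symm
  have : Epi p := epi_of_surjective_app p fun Z => (AddCommGrpCat.epi_iff_surjective _).1
    (inferInstanceAs (Epi ((cokernel.π (preadditiveYoneda.map f)).app Z)))
  have hfp : representableMap f ≫ p = 0 :=
    ObjectProperty.hom_ext _ (cokernel.condition (preadditiveYoneda.map f))
  obtain ⟨K, k, _, _, hkp, hk⟩ := exists_projective_kernel h p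
  obtain ⟨q, hq⟩ := hk (representableMap f) hfp
  -- Any `C(-, Z) ⟶ K` factors through `q`: composed with `k` it is some `C(-, y)` killed by `p`,
  -- and `hp` applies to `y`.
  have : Epi q := by
    refine epi_of_surjective_app q fun Z s => ?_
    let σ : representableModule Z.unop ⟶ K := ObjectProperty.homMk (homOfElement K.obj s)
    obtain ⟨y, hy⟩ := representableMap_surjective (σ ≫ k)
    obtain ⟨x, hx⟩ := hp y (by rw [hy, Category.assoc, hkp, comp_zero])
    have hxq : representableMap x ≫ q = σ := by
      rw [← cancel_mono k, Category.assoc, hq, ← representableMap_comp, hx, hy]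
    refine ⟨x, ?_⟩
    have := ConcreteCategory.congr_hom
      (NatTrans.congr_app (congrArg InducedCategory.Hom.hom hxq) Z) (𝟙 Z.unop)
    refine (congrArg (q.hom.app Z) (Category.id_comp x).symm).trans (this.trans ?_)
    change K.obj.map (𝟙 _) s = s
    simp
  obtain ⟨s, hs⟩ := Projective.factors (𝟙 K) q
  obtain ⟨e, he⟩ := representableMap_surjective (q ≫ s)
  refine ⟨e, representableMap_injective ?_, fun Z a ha => representableMap_injective ?_⟩
  · rw [representableMap_comp, he, ← hq, Category.assoc, reassoc_of% hs]
  · have haq : representableMap a ≫ q = 0 := by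
      rw [← cancel_mono k, Category.assoc, hq, ← representableMap_comp, ha,
        representableMap_zero, zero_comp]
    rw [representableMap_comp, he, reassoc_of% haq, zero_comp, representableMap_zero]

theorem KernelsSplit.isRightCoherentGlobalDimLEOne [IsIdempotentComplete C] (h : KernelsSplit C) :
    IsRightCoherentGlobalDimLEOne C := by
  have := h.isClosedUnderKernels
  refine ⟨inferInstance, iSup_le fun F => ?_⟩
  refine (projectiveDimension_le_iff F 1).2 ?_
  obtain ⟨_, X, Y, f, t, ht⟩ := (finitelyPresentedModule_iff _).1 F.2
  obtain ⟨e, he, ha⟩ := h f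
  have hee : e ≫ e = e := by
    have := ha (𝟙 X - e) (by simp [he])
    rw [Preadditive.sub_comp, Category.id_comp, sub_eq_zero] at this
    exact this.symm
  -- With `X'` the image of `e`, the sequence `0 ⟶ C(-, X') ⟶ C(-, Y) ⟶ F ⟶ 0` is exact.
  obtain ⟨X', i, r, hir, hri⟩ := IsIdempotentComplete.idempotents_split X e hee
  let p : representableModule Y ⟶ F := ObjectProperty.homMk (homOfElement F.obj t)
  have hp : ∀ {Z : C} (y : Z ⟶ Y), p.hom.app (op Z) y = 0 ↔ ∃ x : Z ⟶ X', x ≫ i ≫ f = y := by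
    intro Z y
    refine (ht.map_eq_zero_iff y).trans ⟨?_, ?_⟩
    · rintro ⟨x, rfl⟩
      exact ⟨x ≫ r, by rw [Category.assoc, reassoc_of% hri, he]⟩
    · rintro ⟨x, rfl⟩
      exact ⟨x ≫ i, Category.assoc _ _ _⟩
  have hmono : ∀ {Z : C} (x : Z ⟶ X'), x ≫ i ≫ f = 0 → x = 0 := by
    intro Z x hx
    have h1 := ha (x ≫ i) ((Category.assoc _ _ _).trans hx)
    have h2 := congrArg (· ≫ r) h1
    simpa [← hri, hir] using h2
  have hS : (ShortComplex.mk (representableMap (i ≫ f)) p (by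
      ext Z x
      exact (hp (Z := Z.unop) _).2 ⟨x, rfl⟩)).ShortExact :=
    { exact := by
        have : (finitelyPresentedModule C).ι.PreservesHomology :=
          ⟨ObjectProperty.preservesKernels_ι _, ObjectProperty.preservesCokernels_ι _⟩
        rw [← ShortComplex.exact_map_iff_of_faithful _ (finitelyPresentedModule C).ι,
          exact_iff_forall_app]
        exact fun Z y hy => (hp (Z := Z.unop) y).1 hy
      mono_f := by
        have : Mono ((finitelyPresentedModule C).ι.map (representableMap (i ≫ f))) := by
          refine (NatTrans.mono_iff_mono_app _).2 fun Z =>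
            (AddCommGrpCat.mono_iff_injective _).2 ?_
          refine (injective_iff_map_eq_zero (AddCommGrpCat.Hom.hom _)).2 fun x hx => ?_
          exact hmono (Z := Z.unop) x hx
        exact (finitelyPresentedModule C).ι.mono_of_mono_map this
      epi_g := epi_of_surjective_app p fun Z s => ht.exists_map_eq (Z := Z.unop) s }
  exact hS.hasProjectiveDimensionLT_X₃ 1 inferInstance inferInstance

end Additive
end ModAbelian

/-! ### The equivalence with finitely generated projective modules -/

section Projectivization
variable {C : Type w} [Category.{v} C] [Preadditive C] {X : C}

theorem HasCoordinates.faithful (hX : HasCoordinates X) :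
    (preadditiveCoyonedaObj X).Faithful where
  map_injective {Y Z f g} h := by
    obtain ⟨n, p, j, hpj⟩ := hX Y
    have hj : ∀ i, j i ≫ f = j i ≫ g := fun i =>
      ConcreteCategory.congr_hom h (j i)
    rw [← Category.id_comp f, ← Category.id_comp g, ← hpj, Preadditive.sum_comp,
      Preadditive.sum_comp]
    exact Finset.sum_congr rfl fun i _ => by rw [Category.assoc, hj, Category.assoc]

theorem sum_smul_of_sum_comp_eq_id {Y : C} {n : ℕ} {p : Fin n → (Y ⟶ X)} {j : Fin n → (X ⟶ Y)}
    (h : ∑ i, p i ≫ j i = 𝟙 Y) (x : X ⟶ Y) :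
    ∑ i, MulOpposite.op (α := End X) (x ≫ p i) • j i = x := by
  have := congrArg (x ≫ ·) h
  simp only [Preadditive.comp_sum, Category.comp_id] at this
  exact Eq.trans (Finset.sum_congr rfl fun i _ => Category.assoc _ _ _) this

theorem HasCoordinates.full (hX : HasCoordinates X) : (preadditiveCoyonedaObj X).Full where
  map_surjective {Y Z} φ := by
    obtain ⟨n, p, j, hpj⟩ := hX Y
    let φ' : (X ⟶ Y) →ₗ[(End X)ᵐᵒᵖ] (X ⟶ Z) := φ.hom
    have key : ∀ x : X ⟶ Y, x ≫ ∑ i, p i ≫ φ' (j i) = φ' x := fun x => by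
      conv_rhs => rw [← sum_smul_of_sum_comp_eq_id hpj x, map_sum]
      rw [Preadditive.comp_sum]
      refine Finset.sum_congr rfl fun i _ => ?_
      rw [map_smul]
      exact (Category.assoc _ _ _).symm
    exact ⟨∑ i, p i ≫ φ' (j i), ModuleCat.hom_ext (LinearMap.ext key)⟩

theorem HasCoordinates.finite_projective (hX : HasCoordinates X) (Y : C) :
    Module.Finite (End X)ᵐᵒᵖ ((preadditiveCoyonedaObj X).obj Y) ∧
      Module.Projective (End X)ᵐᵒᵖ ((preadditiveCoyonedaObj X).obj Y) := by
  obtain ⟨n, p, j, hpj⟩ := hX Y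
  let r : (Fin n → (End X)ᵐᵒᵖ) →ₗ[(End X)ᵐᵒᵖ] (X ⟶ Y) := Fintype.linearCombination _ j
  let s : (X ⟶ Y) →ₗ[(End X)ᵐᵒᵖ] (Fin n → (End X)ᵐᵒᵖ) :=
    LinearMap.pi fun i =>
      { toFun := fun x => MulOpposite.op (show End X from x ≫ p i)
        map_add' := fun x y => by
          apply MulOpposite.unop_injective
          exact Preadditive.add_comp _ _ _ _ _ _
        map_smul' := fun a x => by
          apply MulOpposite.unop_injective
          exact Category.assoc _ _ _ }
  have hrs : r ∘ₗ s = LinearMap.id := LinearMap.ext fun x =>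
    (Fintype.linearCombination_apply _ _ _).trans (sum_smul_of_sum_comp_eq_id hpj x)
  exact ⟨Module.Finite.of_surjective r fun x => ⟨s x, LinearMap.congr_fun hrs x⟩,
    Module.Projective.of_split s r hrs⟩

/-- The functor `Hom(X, -)` from `C` to finitely generated projective right `End X`-modules. -/
def HasCoordinates.toProjCat (hX : HasCoordinates X) : C ⥤ ProjCat (End X) :=
  ObjectProperty.lift _ (preadditiveCoyonedaObj X) hX.finite_projective

theorem HasCoordinates.isEquivalence_toProjCat [HasFiniteBiproducts C] [IsIdempotentComplete C]
    (hX : HasCoordinates X) : hX.toProjCat.IsEquivalence where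
  faithful := by
    have := hX.faithful
    unfold HasCoordinates.toProjCat
    infer_instance
  full := by
    have := hX.full
    unfold HasCoordinates.toProjCat
    infer_instance
  -- `P` is a retract of `(End X)ⁿ = Hom(X, Xⁿ)`; the corresponding idempotent of `Xⁿ`
  -- splits in `C`.
  essSurj := ⟨fun P => by
    have := hX.full
    have := hX.faithful
    obtain ⟨hfin, hproj⟩ := P.2
    obtain ⟨n, q, hq⟩ := Module.Finite.exists_fin' (End X)ᵐᵒᵖ P.obj
    obtain ⟨s, hs⟩ := Module.projective_lifting_property q LinearMap.id hq
    let B : C := ⨁ fun _ : Fin n => X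
    let φ : (X ⟶ B) ≃ₗ[(End X)ᵐᵒᵖ] (Fin n → (End X)ᵐᵒᵖ) :=
      { toFun := fun x i => MulOpposite.op (show End X from x ≫ biproduct.π _ i)
        invFun := fun v => biproduct.lift fun i => (v i).unop
        map_add' := fun x y => by
          funext i
          apply MulOpposite.unop_injective
          exact Preadditive.add_comp _ _ _ _ _ _
        map_smul' := fun a x => by
          funext i
          apply MulOpposite.unop_injective
          exact Category.assoc _ _ _
        left_inv := fun x => by
          apply biproduct.hom_ext
          simp
        right_inv := fun v => by
          funext i
          apply MulOpposite.unop_injective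
          exact biproduct.lift_π _ _ }
    let a : (preadditiveCoyonedaObj X).obj B ⟶ P.obj := ModuleCat.ofHom (q ∘ₗ φ.toLinearMap)
    let b : P.obj ⟶ (preadditiveCoyonedaObj X).obj B := ModuleCat.ofHom (φ.symm.toLinearMap ∘ₗ s)
    have hba : b ≫ a = 𝟙 _ := by
      ext x
      change q (φ (φ.symm (s x))) = x
      rw [LinearEquiv.apply_symm_apply]
      exact LinearMap.congr_fun hs x
    obtain ⟨e, he⟩ := (preadditiveCoyonedaObj X).map_surjective (a ≫ b)
    obtain ⟨Y, i, r, hir, hri⟩ := IsIdempotentComplete.idempotents_split B e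
      ((preadditiveCoyonedaObj X).map_injective (by
        rw [Functor.map_comp, he, Category.assoc, reassoc_of% hba]))
    let θ : (preadditiveCoyonedaObj X).obj Y ≅ P.obj :=
      { hom := (preadditiveCoyonedaObj X).map i ≫ a
        inv := b ≫ (preadditiveCoyonedaObj X).map r
        hom_inv_id := by
          rw [Category.assoc, ← reassoc_of% he, ← hri, ← Functor.map_comp, ← Functor.map_comp,
            Category.assoc, hir, Category.comp_id, hir, CategoryTheory.Functor.map_id]
        inv_hom_id := by
          rw [Category.assoc, ← Functor.map_comp_assoc, hri, he, Category.assoc, hba,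
            Category.comp_id, hba] }
    exact ⟨Y, ⟨(ObjectProperty.ι _).preimageIso θ⟩⟩⟩

end Projectivization

/-! ### The category of finitely generated projective modules -/

section ProjCat
variable (R : Type u) [Ring R]

/-- The property of right `R`-modules that defines `ProjCat R`. -/
abbrev finiteProjective : ObjectProperty (ModuleCat.{u} Rᵐᵒᵖ) :=
  fun M => Module.Finite Rᵐᵒᵖ M ∧ Module.Projective Rᵐᵒᵖ M

theorem finiteProjective_of_retract {M N : ModuleCat.{u} Rᵐᵒᵖ} (i : M ⟶ N) (r : N ⟶ M)
    (h : i ≫ r = 𝟙 M) (hN : finiteProjective R N) : finiteProjective R M := by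
  obtain ⟨_, _⟩ := hN
  have hri : r.hom ∘ₗ i.hom = LinearMap.id := congrArg ModuleCat.Hom.hom h
  exact ⟨Module.Finite.of_surjective r.hom fun x => ⟨i.hom x, LinearMap.congr_fun hri x⟩,
    Module.Projective.of_split i.hom r.hom hri⟩

instance finiteProjective_isClosedUnderIsomorphisms :
    (finiteProjective R).IsClosedUnderIsomorphisms :=
  ⟨fun e h => finiteProjective_of_retract R e.inv e.hom e.inv_hom_id h⟩

instance isIdempotentComplete_projCat : IsIdempotentComplete (ProjCat R) where
  idempotents_split P e he := by
    obtain ⟨M, i, r, hir, hri⟩ := IsIdempotentComplete.idempotents_split P.obj e.hom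
      (congrArg (fun t => t.hom) he)
    exact ⟨⟨M, finiteProjective_of_retract R i r hir P.2⟩, ObjectProperty.homMk i,
      ObjectProperty.homMk r, ObjectProperty.hom_ext _ hir, ObjectProperty.hom_ext _ hri⟩

theorem hasFiniteBiproducts_projCat : HasFiniteBiproducts (ProjCat R) := by
  have : (finiteProjective R).IsClosedUnderFiniteProducts := by
    refine ⟨fun J _ => ObjectProperty.IsClosedUnderLimitsOfShape.mk' ?_⟩
    rintro _ ⟨D, hD⟩
    have := Fintype.ofFinite J
    let M : J → ModuleCat.{u} Rᵐᵒᵖ := fun j => D.obj ⟨j⟩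
    let φ : limit D ≅ ModuleCat.of Rᵐᵒᵖ (∀ j, M j) :=
      HasLimit.isoOfNatIso Discrete.natIsoFunctor ≪≫
        limit.isoLimitCone (ModuleCat.HasLimit.productLimitCone M)
    have hM₁ : ∀ j, Module.Finite Rᵐᵒᵖ (M j) := fun j => (hD ⟨j⟩).1
    have hM₂ : ∀ j, Module.Projective Rᵐᵒᵖ (M j) := fun j => (hD ⟨j⟩).2
    exact finiteProjective_of_retract R φ.hom φ.inv φ.hom_inv_id ⟨inferInstance,
      Module.Projective.of_equiv (DFinsupp.linearEquivFunOnFintype (R := Rᵐᵒᵖ) (M := fun j => M j))⟩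
  exact HasFiniteBiproducts.of_hasFiniteProducts

/-- The right `R`-module `R` is the regular left module of the opposite ring. -/
def opSelfLinearEquiv : R ≃ₗ[Rᵐᵒᵖ] Rᵐᵒᵖ :=
  { MulOpposite.opAddEquiv with
    map_smul' := fun _ _ => rfl }

/-- The ring `R` as an object of `proj R`. -/
def ProjCat.self : ProjCat R :=
  ⟨ModuleCat.of Rᵐᵒᵖ R, Module.Finite.equiv (opSelfLinearEquiv R).symm,
    Module.Projective.of_equiv (opSelfLinearEquiv R).symm⟩

theorem hasCoordinates_self : HasCoordinates (ProjCat.self R) := by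
  intro P
  obtain ⟨hfin, hproj⟩ := P.2
  obtain ⟨n, q, hq⟩ := Module.Finite.exists_fin' Rᵐᵒᵖ P.obj
  obtain ⟨s, hs⟩ := Module.projective_lifting_property q LinearMap.id hq
  let p : Fin n → (P ⟶ ProjCat.self R) := fun i => ObjectProperty.homMk
    (ModuleCat.ofHom ((opSelfLinearEquiv R).symm.toLinearMap ∘ₗ LinearMap.proj i ∘ₗ s))
  let j : Fin n → (ProjCat.self R ⟶ P) := fun i => ObjectProperty.homMk
    (ModuleCat.ofHom (q ∘ₗ LinearMap.single _ _ i ∘ₗ (opSelfLinearEquiv R).toLinearMap))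
  refine ⟨n, p, j, ?_⟩
  apply (ObjectProperty.ι _).map_injective
  rw [Functor.map_sum]
  ext x
  change (∑ i, (p i ≫ j i).hom).hom x = x
  rw [ModuleCat.hom_sum, LinearMap.sum_apply]
  have h1 : ∀ i, (p i ≫ j i).hom.hom x = q (Pi.single i (s x i)) := fun i => rfl
  simp_rw [h1]
  rw [← map_sum, Finset.univ_sum_single]
  exact LinearMap.congr_fun hs x

/-- Left multiplication identifies `R` with the endomorphism ring of the right module `R`. -/
def endSelfEquiv : End (ProjCat.self R) ≃+* R :=
  RingEquiv.trans
    { toFun := fun f => f.hom.hom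
      invFun := fun f => ObjectProperty.homMk (ModuleCat.ofHom f)
      left_inv := fun _ => rfl
      right_inv := fun _ => rfl
      map_mul' := fun _ _ => rfl
      map_add' := fun _ _ => rfl } (RingEquiv.moduleEndSelfOp R).symm
end ProjCat

/-! ### Morita equivalence -/

section Morita

theorem OrderIso.isCompactElement {α β : Type*} [PartialOrder α] [PartialOrder β] (φ : α ≃o β)
    {k : α} (h : IsCompactElement k) : IsCompactElement (φ k) := by
  intro s b hs hdir hlub hb
  obtain ⟨x, hx, hkx⟩ := h (φ.symm '' s) (φ.symm b) (hs.image _)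
    (by
      rintro _ ⟨x, hx, rfl⟩ _ ⟨y, hy, rfl⟩
      obtain ⟨z, hz, hxz, hyz⟩ := hdir x hx y hy
      exact ⟨_, ⟨z, hz, rfl⟩, φ.symm.monotone hxz, φ.symm.monotone hyz⟩)
    (φ.symm.isLUB_image'.2 hlub) (φ.le_symm_apply.2 hb)
  obtain ⟨y, hy, rfl⟩ := hx
  exact ⟨y, hy, φ.le_symm_apply.1 hkx⟩

theorem finite_iff_isCompactElement_top {A : Type u} [Ring A] (M : ModuleCat.{u} A) :
    Module.Finite A M ↔ IsCompactElement (⊤ : Subobject M) := by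
  rw [Module.finite_def, Submodule.fg_iff_compact]
  have h := map_top (ModuleCat.subobjectModule M)
  have h' := map_top (ModuleCat.subobjectModule M).symm
  exact ⟨fun hc => h' ▸ (ModuleCat.subobjectModule M).symm.isCompactElement hc,
    fun hc => h ▸ (ModuleCat.subobjectModule M).isCompactElement hc⟩

theorem finite_functor_obj {A B : Type u} [Ring A] [Ring B] (e : ModuleCat.{u} A ≌ ModuleCat.{u} B)
    (M : ModuleCat.{u} A) (h : Module.Finite A M) : Module.Finite B (e.functor.obj M) := by
  rw [finite_iff_isCompactElement_top] at h ⊢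
  let φ : Subobject M ≃o Subobject (e.functor.obj M) :=
    (Subobject.lowerEquivalence (MonoOver.congr M e)).toOrderIso
  exact map_top φ ▸ φ.isCompactElement h

theorem projective_functor_obj {A B : Type u} [Ring A] [Ring B]
    (e : ModuleCat.{u} A ≌ ModuleCat.{u} B)
    (M : ModuleCat.{u} A) (h : Module.Projective A M) : Module.Projective B (e.functor.obj M) := by
  have h' : Projective M := (IsProjective.iff_projective M).1 h
  exact (IsProjective.iff_projective _).2 ((e.map_projective_iff M).2 h')

theorem nonempty_projCat_equivalence {R S : Type u} [Ring R] [Ring S]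
    (h : IsMoritaEquivalent ℤ Rᵐᵒᵖ Sᵐᵒᵖ) : Nonempty (ProjCat R ≌ ProjCat S) := by
  obtain ⟨⟨e, _⟩⟩ := h
  refine ⟨e.congrFullSubcategory (P := finiteProjective R) (Q := finiteProjective S) ?_⟩
  ext M
  refine ⟨fun ⟨h₁, h₂⟩ => ?_, fun ⟨h₁, h₂⟩ =>
    ⟨finite_functor_obj e M h₁, projective_functor_obj e M h₂⟩⟩
  exact finiteProjective_of_retract R (e.unitIso.app M).hom (e.unitIso.app M).inv
    (e.unitIso.app M).hom_inv_id
    ⟨finite_functor_obj e.symm _ h₁, projective_functor_obj e.symm _ h₂⟩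

/-- Additive functors are linear over `ℤ`, for any `ℤ`-linear structures: these are unique. The
structures are implicit rather than instance arguments because `ModuleCat` has several, not
definitionally equal. -/
theorem linear_int_of_additive {A B : Type*} [Category* A] [Category* B] [Preadditive A]
    [Preadditive B] {_ : Linear ℤ A} {_ : Linear ℤ B} (F : A ⥤ B) [F.Additive] :
    F.Linear ℤ where
  map_smul f r := (congrArg F.map (int_smul_eq_zsmul _ r f)).trans
    (F.map_zsmul.trans (int_smul_eq_zsmul _ r (F.map f)).symm)

open scoped ModuleCat.Algebra in
theorem isMoritaEquivalent_int_of_equivalence {A B : Type u} [Ring A] [Ring B] [Algebra ℤ A]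
    [Algebra ℤ B] (e : ModuleCat.{u} A ≌ ModuleCat.{u} B) : IsMoritaEquivalent ℤ A B := by
  have := e.functor.additive_of_preserves_binary_products
  exact ⟨⟨⟨e, linear_int_of_additive e.functor⟩⟩⟩

/-- Restriction of scalars along an isomorphism of rings, for right modules. -/
noncomputable def moduleCatOpEquivalence {R S : Type u} [Ring R] [Ring S] (φ : R ≃+* S) :
    ModuleCat.{u} Rᵐᵒᵖ ≌ ModuleCat.{u} Sᵐᵒᵖ :=
  ModuleCat.restrictScalarsEquivalenceOfRingEquiv (RingEquiv.op φ).symm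

open Opposite
variable {C : Type w} [Category.{v} C] [Preadditive C]

/-- The right `End X`-module structure on `F(X)` for a contravariant additive functor `F`. -/
@[reducible]
def evalModule (F : Cᵒᵖ ⥤+ AddCommGrpCat.{v}) (X : C) : Module (End X)ᵐᵒᵖ (F.obj.obj (op X)) where
  smul a m := F.obj.map a.unop.op m
  one_smul m := by
    change F.obj.map (𝟙 X).op m = m
    simp
  mul_smul a b m := by
    change F.obj.map (a.unop ≫ b.unop).op m = F.obj.map a.unop.op (F.obj.map b.unop.op m)
    simp
  smul_zero a := map_zero _
  smul_add a m m' := map_add _ _ _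
  add_smul a b m := by
    have := F.obj.map_add (f := (a.unop : X ⟶ X).op) (g := (b.unop : X ⟶ X).op)
    exact ConcreteCategory.congr_hom this m
  zero_smul m := by
    change F.obj.map (0 : X ⟶ X).op m = 0
    simp

/-- Evaluation at `X`, from contravariant additive functors to right `End X`-modules. -/
def evalFunctor (X : C) : (Cᵒᵖ ⥤+ AddCommGrpCat.{v}) ⥤ ModuleCat.{v} (End X)ᵐᵒᵖ where
  obj F := letI := evalModule F X; ModuleCat.of _ (F.obj.obj (op X))
  map {F G} α := letI := evalModule F X; letI := evalModule G X; ModuleCat.ofHom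
    { toFun := fun m => α.hom.app (op X) m
      map_add' := fun m m' => map_add _ _ _
      map_smul' := fun a m => NatTrans.naturality_apply α.hom _ _ }

variable {X : C}

theorem eq_sum_map_map {F : Cᵒᵖ ⥤ AddCommGrpCat.{v}} [F.Additive] {Y : C} {n : ℕ}
    {p : Fin n → (Y ⟶ X)} {j : Fin n → (X ⟶ Y)} (h : ∑ i, p i ≫ j i = 𝟙 Y) (y : F.obj (op Y)) :
    ∑ i, F.map (p i).op (F.map (j i).op y) = y := by
  let ev : (Y ⟶ Y) →+ F.obj (op Y) :=
    { toFun := fun g => F.map g.op y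
      map_zero' := by simp
      map_add' := fun a b => by simp [F.map_add] }
  have := congrArg ev h
  rw [map_sum] at this
  simpa [ev] using this

theorem HasCoordinates.faithful_evalFunctor (hX : HasCoordinates X) :
    (evalFunctor X).Faithful where
  map_injective {F G α β} h := by
    ext Y y
    obtain ⟨n, p, j, hpj⟩ := hX Y.unop
    have hj : ∀ m : F.obj.obj (op X), α.hom.app (op X) m = β.hom.app (op X) m := fun m =>
      ConcreteCategory.congr_hom h m
    rw [← eq_sum_map_map (F := F.obj) hpj y, map_sum, map_sum]
    exact Finset.sum_congr rfl fun i _ =>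
      ((NatTrans.naturality_apply α.hom (p i).op _).trans (congrArg _ (hj _))).trans
        (NatTrans.naturality_apply β.hom (p i).op _).symm

/-- An `End X`-linear map `φ : F(X) ⟶ G(X)` extends to `F(Y) ⟶ G(Y)` by
`y ↦ ∑ i, G(p i) (φ (F(j i) y))`. -/
theorem HasCoordinates.full_evalFunctor (hX : HasCoordinates X) : (evalFunctor X).Full where
  map_surjective {F G} φ := by
    choose n p j hpj using hX
    let φ' : F.obj.obj (op X) →+ G.obj.obj (op X) := φ.hom.toAddMonoidHom
    have hφ : ∀ (a : X ⟶ X) m, φ' (F.obj.map a.op m) = G.obj.map a.op (φ' m) := fun a m =>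
      φ.hom.map_smul (MulOpposite.op (α := End X) a) m
    let t : ∀ Y : C, F.obj.obj (op Y) →+ G.obj.obj (op Y) := fun Y =>
      ∑ i, (G.obj.map (p Y i).op).hom.comp (φ'.comp (F.obj.map (j Y i).op).hom)
    have ht : ∀ Y y, t Y y = ∑ i, G.obj.map (p Y i).op (φ' (F.obj.map (j Y i).op y)) :=
      fun Y y => by simp [t]
    -- `t` is compatible with maps into `X`
    have hcomp : ∀ {W : C} (g : X ⟶ W) (y : F.obj.obj (op W)),
        φ' (F.obj.map g.op y) = G.obj.map g.op (t W y) := fun {W} g y => by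
      conv_lhs => rw [← eq_sum_map_map (F := F.obj) (hpj W) y, map_sum, map_sum]
      rw [ht, map_sum]
      refine Finset.sum_congr rfl fun i _ => ?_
      have h₁ := hφ (g ≫ p W i) (F.obj.map (j W i).op y)
      simpa using h₁
    let α : F ⟶ G := ObjectProperty.homMk
      { app := fun Y => AddCommGrpCat.ofHom (t Y.unop)
        naturality := fun Y W g => by
          ext y
          change t W.unop (F.obj.map g y) = G.obj.map g (t Y.unop y)
          rw [← eq_sum_map_map (F := G.obj) (hpj W.unop) (G.obj.map g (t Y.unop y)), ht]
          refine Finset.sum_congr rfl fun i _ => congrArg _ ?_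
          have := hcomp (j W.unop i ≫ g.unop) y
          simpa using this }
    refine ⟨α, ?_⟩
    ext m
    have := hcomp (𝟙 X) m
    rw [op_id, F.obj.map_id, G.obj.map_id] at this
    exact this.symm

/-- The module `M` is the value at `X` of the functor `Hom(Hom(X, -), M)`. -/
theorem essSurj_evalFunctor (X : C) : (evalFunctor X).EssSurj where
  mem_essImage M := by
    let F : Cᵒᵖ ⥤ AddCommGrpCat.{v} := (preadditiveCoyonedaObj X).op ⋙ preadditiveYoneda.obj M
    have : F.Additive := inferInstance
    let φ : (evalFunctor X).obj (AdditiveFunctor.of F) ≃ₗ[(End X)ᵐᵒᵖ] M :=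
      { toFun := fun f => (show (preadditiveCoyonedaObj X).obj X ⟶ M from f).hom (𝟙 X)
        invFun := fun m => ModuleCat.ofHom (X := (preadditiveCoyonedaObj X).obj X)
          { toFun := fun a => MulOpposite.op (α := End X) a • m
            map_add' := fun a b => add_smul (MulOpposite.op (α := End X) a) (MulOpposite.op b) m
            map_smul' := fun a b => mul_smul a (MulOpposite.op (α := End X) b) m }
        map_add' := fun f g => rfl
        map_smul' := fun a f => by
          let f' : (preadditiveCoyonedaObj X).obj X ⟶ M := f
          refine Eq.trans ?_ (f'.hom.map_smul a (𝟙 X))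
          exact congrArg f'.hom
            ((Category.id_comp (a.unop : X ⟶ X)).trans (Category.comp_id (a.unop : X ⟶ X)).symm)
        left_inv := fun f => by
          let f' : (preadditiveCoyonedaObj X).obj X ⟶ M := f
          refine ModuleCat.hom_ext (LinearMap.ext fun a => ?_)
          refine (f'.hom.map_smul (MulOpposite.op (α := End X) a) (𝟙 X)).symm.trans ?_
          exact congrArg f'.hom (Category.comp_id (obj := C) a)
        right_inv := fun m => one_smul (End X)ᵐᵒᵖ m }
    exact ⟨AdditiveFunctor.of F, ⟨φ.toModuleIso⟩⟩

theorem HasCoordinates.isEquivalence_evalFunctor (hX : HasCoordinates X) :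
    (evalFunctor X).IsEquivalence where
  faithful := hX.faithful_evalFunctor
  full := hX.full_evalFunctor
  essSurj := essSurj_evalFunctor X

/-- The endomorphism rings of two generators of `C` have equivalent categories of right modules,
both being equivalent to the category of contravariant additive functors on `C`. -/
noncomputable def HasCoordinates.moduleCatEquivalence {X Y : C} (hX : HasCoordinates X)
    (hY : HasCoordinates Y) : ModuleCat.{v} (End X)ᵐᵒᵖ ≌ ModuleCat.{v} (End Y)ᵐᵒᵖ :=
  have := hX.isEquivalence_evalFunctor
  have := hY.isEquivalence_evalFunctor
  (evalFunctor X).asEquivalence.symm.trans (evalFunctor Y).asEquivalence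

end Morita

/-! ### The correspondence -/

section Correspondence

theorem hasFiniteBiproducts_op {C : Type w} [Category.{v} C] [Preadditive C]
    [HasFiniteBiproducts C] : HasFiniteBiproducts Cᵒᵖ :=
  HasFiniteBiproducts.of_hasFiniteProducts

theorem isLeftSemihereditary_iff (S : Type u) [Ring S] :
    IsLeftSemihereditary S ↔ MatrixKernelsSplit S :=
  ⟨fun h => h.matrixKernelsSplit, fun h => h.isLeftSemihereditary⟩

/-- The endomorphism ring of `X` in `Cᵒᵖ` is opposite to that in `C`. -/
def endOpEquiv {C : Type w} [Category.{v} C] [Preadditive C] (X : C) :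
    (End (Opposite.op X))ᵐᵒᵖ ≃+* End X where
  toFun f := f.unop.unop
  invFun f := MulOpposite.op f.op
  left_inv _ := rfl
  right_inv _ := rfl
  map_mul' _ _ := rfl
  map_add' _ _ := rfl

theorem isSemihereditary_end_iff {C : Type w} [Category.{v} C] [Preadditive C]
    [HasFiniteBiproducts C] {X : C} (hX : HasCoordinates X) :
    IsSemihereditary (End X) ↔ KernelsSplit C ∧ KernelsSplit Cᵒᵖ := by
  have := hasFiniteBiproducts_op (C := C)
  constructor
  · rintro ⟨hr, hl⟩
    rw [isLeftSemihereditary_iff] at hr hl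
    exact ⟨hX.kernelsSplit hr, hX.op.kernelsSplit (hl.of_ringEquiv (endOpEquiv X).symm)⟩
  · rintro ⟨hr, hl⟩
    refine ⟨(isLeftSemihereditary_iff _).2 (hr.matrixKernelsSplit X),
      (isLeftSemihereditary_iff _).2 ?_⟩
    exact (hl.matrixKernelsSplit (Opposite.op X)).of_ringEquiv (endOpEquiv X)

theorem isZeroAbelian_iff {C : Type w} [Category.{v} C] [Preadditive C]
    [HasFiniteBiproducts C] [IsIdempotentComplete C] :
    IsZeroAbelian C ↔ KernelsSplit C ∧ KernelsSplit Cᵒᵖ := by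
  have := hasFiniteBiproducts_op (C := C)
  exact ⟨fun h => ⟨h.right.kernelsSplit, h.left.kernelsSplit⟩, fun h =>
    { right := h.1.isRightCoherentGlobalDimLEOne
      left := h.2.isRightCoherentGlobalDimLEOne }⟩

theorem IsSemihereditary.of_ringEquiv {R S : Type u} [Ring R] [Ring S] (φ : R ≃+* S)
    (h : IsSemihereditary R) : IsSemihereditary S := by
  obtain ⟨hr, hl⟩ := h
  rw [isLeftSemihereditary_iff] at hr hl
  exact ⟨(isLeftSemihereditary_iff _).2 (hr.of_ringEquiv (RingEquiv.op φ)),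
    (isLeftSemihereditary_iff _).2 (hl.of_ringEquiv φ)⟩

theorem IsSemihereditary.isZeroAbelian_projCat {R : Type u} [Ring R] (h : IsSemihereditary R) :
    IsZeroAbelian (ProjCat R) :=
  have := hasFiniteBiproducts_projCat R
  isZeroAbelian_iff.2 ((isSemihereditary_end_iff (hasCoordinates_self R)).1
    (h.of_ringEquiv (endSelfEquiv R).symm))

theorem isAdditiveGenerator_self (R : Type u) [Ring R] [HasFiniteBiproducts (ProjCat R)] :
    IsAdditiveGenerator (ProjCat.self R) :=
  (hasCoordinates_self R).isAdditiveGenerator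

theorem nonempty_moduleCat_equivalence {C D : Type w} [Category.{v} C] [Category.{v} D]
    [Preadditive C] [Preadditive D] [HasFiniteBiproducts C] (e : C ≌ D) {X : C} {Y : D}
    (hX : HasCoordinates X) (hY : HasCoordinates Y) :
    Nonempty (ModuleCat.{v} (End X)ᵐᵒᵖ ≌ ModuleCat.{v} (End Y)ᵐᵒᵖ) := by
  have : HasBinaryBiproducts C := hasBinaryBiproducts_of_finite_biproducts C
  have : e.functor.Additive := e.functor.additive_of_preserves_binary_products
  have hFX : HasCoordinates (e.functor.obj X) := by
    intro Z
    obtain ⟨n, p, j, hpj⟩ := hX (e.inverse.obj Z)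
    refine ⟨n, fun i => e.counitInv.app Z ≫ e.functor.map (p i),
      fun i => e.functor.map (j i) ≫ e.counit.app Z, ?_⟩
    have := congrArg (fun t => e.counitInv.app Z ≫ e.functor.map t ≫ e.counit.app Z) hpj
    simpa [Preadditive.comp_sum, Preadditive.sum_comp, Functor.map_sum] using this
  let φ : End X ≃+* End (e.functor.obj X) :=
    { e.fullyFaithfulFunctor.mulEquivEnd X with
      map_add' := fun f g => e.functor.map_add }
  exact ⟨(moduleCatOpEquivalence φ).trans (hFX.moduleCatEquivalence hY)⟩

namespace ZeroAbelianCatWithGenerator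

/-- A chosen additive generator. -/
noncomputable def generator (C : ZeroAbelianCatWithGenerator.{u}) : C.carrier :=
  C.exists_generator.choose

theorem hasCoordinates_generator (C : ZeroAbelianCatWithGenerator.{u}) :
    HasCoordinates C.generator :=
  IsAdditiveGenerator.hasCoordinates C.exists_generator.choose_spec

theorem isSemihereditary_end (C : ZeroAbelianCatWithGenerator.{u}) {X : C.carrier}
    (hX : HasCoordinates X) : IsSemihereditary (End X) :=
  (isSemihereditary_end_iff hX).2 (isZeroAbelian_iff.1 inferInstance)

/-- The endomorphism ring of the chosen generator, as a semi-hereditary ring. -/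
noncomputable def endGenerator (C : ZeroAbelianCatWithGenerator.{u}) : SemihereditaryRing.{u} :=
  ⟨End C.generator, C.isSemihereditary_end C.hasCoordinates_generator⟩

end ZeroAbelianCatWithGenerator

theorem SemihereditaryRing.equiv_of_equivalence {R S : SemihereditaryRing.{u}}
    (e : ModuleCat.{u} R.carrierᵐᵒᵖ ≌ ModuleCat.{u} S.carrierᵐᵒᵖ) : R ≈ S :=
  isMoritaEquivalent_int_of_equivalence e

/-- The category `proj R`, as a `0`-abelian category with an additive generator. -/
def SemihereditaryRing.projCat (R : SemihereditaryRing.{u}) : ZeroAbelianCatWithGenerator.{u} :=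
  haveI := R.isSemihereditary.isZeroAbelian_projCat
  ⟨ProjCat R.carrier, ⟨_, isAdditiveGenerator_self R.carrier⟩⟩

/-- The bijection between `0`-abelian categories with additive generators up to equivalence and
semi-hereditary rings up to Morita equivalence. -/
noncomputable def zeroAbelianClassEquiv : ZeroAbelianClass.{u} ≃ SemihereditaryMoritaClass.{u} where
  toFun := Quotient.map ZeroAbelianCatWithGenerator.endGenerator fun C D ⟨e⟩ =>
    have ⟨e'⟩ := nonempty_moduleCat_equivalence e C.hasCoordinates_generator
      D.hasCoordinates_generator
    SemihereditaryRing.equiv_of_equivalence e'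
  invFun := Quotient.map SemihereditaryRing.projCat fun R S h =>
    nonempty_projCat_equivalence (R := R.carrier) (S := S.carrier) h
  left_inv := by
    rintro ⟨C⟩
    have := C.hasCoordinates_generator.isEquivalence_toProjCat
    exact Quotient.sound ⟨C.hasCoordinates_generator.toProjCat.asEquivalence.symm⟩
  right_inv := by
    rintro ⟨R⟩
    refine Quotient.sound ?_
    have e := HasCoordinates.moduleCatEquivalence (C := ProjCat R.carrier)
      R.projCat.hasCoordinates_generator (hasCoordinates_self R.carrier)
    exact SemihereditaryRing.equiv_of_equivalence
      (e.trans (moduleCatOpEquivalence (endSelfEquiv R.carrier)))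

end Correspondence

theorem theorem9 :
    ∃ e : ZeroAbelianClass.{u} ≃ SemihereditaryMoritaClass.{u},
      (∀ (C : ZeroAbelianCatWithGenerator.{u}) (X : C.carrier), IsAdditiveGenerator X →
        ∃ h : IsSemihereditary (End X),
          e (Quotient.mk _ C) = Quotient.mk _ (SemihereditaryRing.mk (End X) h)) ∧
      (∀ (R : Type u) [Ring R] (hR : IsSemihereditary R),
        ∃ (_ : IsZeroAbelian (ProjCat R)) (h : ∃ P : ProjCat R, IsAdditiveGenerator P),
          e.symm (Quotient.mk _ (SemihereditaryRing.mk R hR)) =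
            Quotient.mk _ (ZeroAbelianCatWithGenerator.mk (ProjCat R) h)) := by
  refine ⟨zeroAbelianClassEquiv, fun C X hX => ⟨C.isSemihereditary_end hX.hasCoordinates, ?_⟩,
    fun R _ hR => have := hR.isZeroAbelian_projCat; ⟨this, ⟨_, isAdditiveGenerator_self R⟩, rfl⟩⟩
  exact Quotient.sound (SemihereditaryRing.equiv_of_equivalence
    (C.hasCoordinates_generator.moduleCatEquivalence hX.hasCoordinates))
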